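/- For a multi-index $\mu\in\mathbb N^k$ write $|\mu|=\mu_1+\dots+\mu_k$ and $\mu!=\mu_1!\cdots\mu_k!$. For real numbers $A,C$, a function $\varphi:(0,1)^k\to\mathbb R$ is called $(A,C)$-mild if it is $C^\infty$ and $|D^\mu\varphi(z)|\le \mu!\,(A|\mu|^C)^{|\mu|}$ for all $\mu\in\mathbb N^k$ and all $z\in(0,1)^k$ (the right-hand side being $1$ for $\mu=0$). A set $X\subset\mathbb R^n$ has a $(J,A,C)$-mild parametrization by $(0,1)^k$ if it is covered by the images of $J$ maps $(0,1)^k\to\mathbb R^n$ all of whose coordinate functions are $(A,C)$-mild. (The usual notion of a $(J,A,C)$-mild parametrization of a set $X$ is the one with $k=\dim X$.) For a number field $K\subset\mathbb C$ and $T\ge 1$ let $X(K,T)$ be the set of points of $X$ all of whose coordinates lie in $K$ and have absolute multiplicative Weil height at most $T$. A hypersurface in $\mathbb R^n$ of degree at most $D$ is the set of real zeros of a nonconstant real polynomial in $n$ variables of total degree at most $D$. **Theorem.** There are computable functions $F_1,F_2,F_3:\mathbb N^5\to\mathbb N$ with the following property. Let $J,n,k\in\mathbb N$ with $k<n$, let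 $A,C\in\mathbb R$, and let $X\subset(0,1)^n$ have a $(J,A,C)$-mild parametrization by $(0,1)^k$ (for instance with $k=\dim X$). Put $C_i=F_i\bigl(J,\max(0,\lceil A\rceil),\max(0,\lceil C\rceil),n,k\bigr)$ for $i=1,2,3$. Then for every number field $K\subset\mathbb C$, with $d=[K:\mathbb Q]$, and every real $T\ge e$, the set $X(K,T)$ is contained in the union of at most $C_1\,d^{C_2}(\log T)^{C_3}$ hypersurfaces in $\mathbb R^n$ of degree at most $(d^2\log T)^{k/(n-k)}$. -/

import Mathlib

open scoped ContDiff

noncomputable section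

/-- The open unit cube `(0,1)^k` in `ℝ^k`. -/
def openUnitCube (k : ℕ) : Set (Fin k → ℝ) :=
  Set.univ.pi fun _ => Set.Ioo (0 : ℝ) 1

/-- The mixed partial derivative `D^μ φ (z) = ∂^{|μ|} φ / ∂z₁^{μ₁} ⋯ ∂z_k^{μ_k} (z)` for a
multi-index `μ ∈ ℕ^k`: the iterated derivative of order `|μ| = μ₁ + ⋯ + μ_k`, evaluated on the
list of standard basis vectors in which the `i`-th basis vector occurs `μ i` times. -/
def mixedPartial {k : ℕ} (μ : Fin k → ℕ) (φ : (Fin k → ℝ) → ℝ) (z : Fin k → ℝ) : ℝ :=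
  iteratedFDeriv ℝ (∑ i, μ i) φ z
    fun s => Pi.single (finSigmaFinEquiv.symm s).1 (1 : ℝ)

/-- `φ` is `(A,C)`-mild on the open unit cube: it is `C^∞` there and
`|D^μ φ (z)| ≤ μ! (A |μ|^C)^{|μ|}` for all multi-indices `μ` and all `z` in the cube
(for `μ = 0` the right-hand side is `1`). -/
def IsMild {k : ℕ} (A C : ℝ) (φ : (Fin k → ℝ) → ℝ) : Prop :=
  ContDiffOn ℝ ∞ φ (openUnitCube k) ∧
    ∀ μ : Fin k → ℕ, ∀ z ∈ openUnitCube k,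
      |mixedPartial μ φ z| ≤
        ((∏ i, (μ i).factorial : ℕ) : ℝ) * (A * ((∑ i, μ i : ℕ) : ℝ) ^ C) ^ (∑ i, μ i)

/-- `X ⊆ ℝ^n` has a `(J,A,C)`-mild parametrization by the `k`-dimensional unit cube: it is
covered by the images of `J` maps `(0,1)^k → ℝ^n` all of whose coordinate functions are
`(A,C)`-mild. (For a set `X` of dimension `k` this is the usual notion.) -/
def HasMildParametrization {n : ℕ} (k J : ℕ) (A C : ℝ) (X : Set (Fin n → ℝ)) : Prop :=
  ∃ θ : Fin J → (Fin k → ℝ) → (Fin n → ℝ),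
    (∀ j i, IsMild A C fun z => θ j z i) ∧ X ⊆ ⋃ j, θ j '' openUnitCube k

/-- The absolute multiplicative Weil height of an element of a number field. Mathlib's
`Height.mulHeight₁` is `∏_v max(1, |a|_v)` without the normalizing exponent `1/[K:ℚ]`. -/
def absWeilHeight {K : Type*} [Field K] [NumberField K] (a : K) : ℝ :=
  Height.mulHeight₁ a ^ (1 / (Module.finrank ℚ K : ℝ))

/-- `X(K,T)`: the points of `X` all of whose coordinates lie in the number field `K ⊂ ℂ` and
have absolute multiplicative Weil height at most `T`. -/
def pointsOfHeightLE {n : ℕ} (X : Set (Fin n → ℝ)) (K : Subfield ℂ) [NumberField K] (T : ℝ) :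
    Set (Fin n → ℝ) :=
  {x | x ∈ X ∧ ∀ i, ∃ a : K, (a : ℂ) = ((x i : ℝ) : ℂ) ∧ absWeilHeight a ≤ T}

/-- `Z` is a hypersurface in `ℝ^n` of degree at most `D`: the real zero set of a nonconstant
real polynomial of total degree at most `D`. -/
def IsHypersurfaceOfDegreeLE {n : ℕ} (D : ℝ) (Z : Set (Fin n → ℝ)) : Prop :=
  ∃ P : MvPolynomial (Fin n) ℝ, 0 < P.totalDegree ∧ (P.totalDegree : ℝ) ≤ D ∧
    Z = {x | MvPolynomial.eval x P = 0}

end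

/-!
The determinant method of Bombieri and Pila, in the form that mild parametrizations allow.

Let `Q = d² log T`, let `D` be the integer part of `Q ^ (k / (n - k))`, and let `N` be the number of
monomials of degree at most `D` in `n` variables. The parameter cube is cut into `R ^ k` cells. It
is enough that, for each of the `J` maps and each cell, all `N × N` determinants
`det (x_i ^ α)` of points of bounded height with parameters in that cell vanish: then the points
satisfy a common nonzero equation of degree at most `D` (`exists_mvPolynomial_of_det_eq_zero`).

* Lower bound. By Liouville's inequality and a place by place estimate of the height of the
  determinant, a nonzero determinant is at least `(N!) ^ (-d) * T ^ (-d n D N)`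
  (`one_le_abs_det_mul`).
* Upper bound. Let `β` be maximal with `2 β ^ k ≤ N`. Taylor expansion to order `β` in the parameter
  approximates the matrix by one of rank at most `β ^ k ≤ N / 2`, with an error `ρ ^ β`, where `ρ`
  is proportional to the side `1 / R` of the cell. A change of basis adapted to the kernel of the
  approximating matrix shows that the determinant is at most `N! N ^ N ρ ^ (β (N - β ^ k))`
  (`abs_det_monomials_le`). Here mildness gives `ρ = D k A β ^ C / R`: a product of `s` functions
  whose derivatives of order `m ≤ β` are bounded by `m! c ^ m` has derivatives bounded by
  `m! (s c) ^ m` (`DerivBound`).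

Counting dimensions gives `β ≫ D Q` (`exists_taylor_order`), so the bounds are incompatible as soon
as `ρ` is below a constant depending on `n` and `k` only (`upper_lower_bound_lt_one`). Hence `R` may
be taken to be a constant times `D β ^ C`, which is polynomial in `Q`, and the number `J R ^ k` of
hypersurfaces has the required form with explicit primitive recursive constants. For `k = 0` the
set has at most `J` points and hyperplanes suffice.
-/

/-! ### Symmetry of iterated derivatives -/

section Symmetry

variable {E F : Type*} [NormedAddCommGroup E] [NormedSpace ℝ E] [NormedAddCommGroup F]
  [NormedSpace ℝ F]

lemma ContDiffOn.hasFDerivAt_iteratedFDeriv {U : Set E} (hU : IsOpen U) {f : E → F}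
    (hf : ContDiffOn ℝ ∞ f U) (m : ℕ) {z : E} (hz : z ∈ U) :
    HasFDerivAt (iteratedFDeriv ℝ m f) (fderiv ℝ (iteratedFDeriv ℝ m f) z) z :=
  ((hf.contDiffAt (hU.mem_nhds hz)).differentiableAt_iteratedFDeriv
    (by exact_mod_cast ENat.natCast_lt_top m)).hasFDerivAt

/-- Invariance of the iterated derivative of a smooth function under adjacent transpositions: the
one exchanging the first two arguments is symmetry of a second derivative, the others come from
the previous order. -/
lemma ContDiffOn.iteratedFDeriv_comp_swap {U : Set E} (hU : IsOpen U) {f : E → F}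
    (hf : ContDiffOn ℝ ∞ f U) (m : ℕ) :
    ∀ z ∈ U, ∀ (i : Fin m) (v : Fin (m + 1) → E),
      iteratedFDeriv ℝ (m + 1) f z (v ∘ Equiv.swap i.castSucc i.succ) =
        iteratedFDeriv ℝ (m + 1) f z v := by
  induction m with
  | zero => intro _ _ i; exact i.elim0
  | succ m ih =>
    intro z hz i v
    -- the iterated derivative of order `q + 1` as a derivative of the one of order `q`
    have hder : ∀ (q : ℕ) (z : E), z ∈ U → ∀ u : Fin q → E,
        HasFDerivAt (fun y => iteratedFDeriv ℝ q f y u)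
          ((ContinuousMultilinearMap.apply ℝ (fun _ : Fin q => E) F u).comp
            (fderiv ℝ (iteratedFDeriv ℝ q f) z)) z := fun q z hz u =>
      (ContinuousMultilinearMap.apply ℝ (fun _ : Fin q => E) F u).hasFDerivAt.comp z
        (hf.hasFDerivAt_iteratedFDeriv hU q hz)
    refine Fin.cases ?_ (fun j => ?_) i
    · have hat : ContDiffAt ℝ 2 (iteratedFDeriv ℝ m f) z :=
        (hf.contDiffAt (hU.mem_nhds hz)).iteratedFDeriv_right (m := 2) (i := m)
          (WithTop.coe_le_coe.2 (le_top : ((2 + m : ℕ) : ℕ∞) ≤ ⊤))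
      have hsymm : IsSymmSndFDerivAt ℝ (iteratedFDeriv ℝ m f) z :=
        hat.isSymmSndFDerivAt (by simp)
      have h2 : ∀ u : Fin (m + 1 + 1) → E, iteratedFDeriv ℝ (m + 1 + 1) f z u =
          fderiv ℝ (fderiv ℝ (iteratedFDeriv ℝ m f)) z (u 0) (u 1) (Fin.tail (Fin.tail u)) := by
        intro u
        rw [iteratedFDeriv_succ_apply_left]
        have e1 := hder (m + 1) z hz (Fin.tail u)
        have hd2 : HasFDerivAt (fderiv ℝ (iteratedFDeriv ℝ m f))
            (fderiv ℝ (fderiv ℝ (iteratedFDeriv ℝ m f)) z) z :=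
          ((hat.fderiv_right (m := 1) (by norm_num)).differentiableAt (by simp)).hasFDerivAt
        have hd3 : HasFDerivAt (fun y => fderiv ℝ (iteratedFDeriv ℝ m f) y (Fin.tail u 0)) _ z :=
          hd2.clm_apply (hasFDerivAt_const (Fin.tail u 0) z)
        have e2 := (ContinuousMultilinearMap.apply ℝ (fun _ : Fin m => E) F
          (Fin.tail (Fin.tail u))).hasFDerivAt.comp z hd3
        have := e1.unique e2
        simpa [Fin.tail] using congrArg (fun L => L (u 0)) this
      rw [h2, h2]
      have t0 : (v ∘ Equiv.swap (Fin.castSucc (0 : Fin (m + 1))) (Fin.succ 0)) 0 = v 1 := by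
        simp
      have t1 : (v ∘ Equiv.swap (Fin.castSucc (0 : Fin (m + 1))) (Fin.succ 0)) 1 = v 0 := by
        simp
      have t2 : Fin.tail (Fin.tail (v ∘ Equiv.swap (Fin.castSucc (0 : Fin (m + 1)))
          (Fin.succ 0))) = Fin.tail (Fin.tail v) := by
        funext s
        simp only [Fin.tail, Function.comp]
        rw [Equiv.swap_apply_of_ne_of_ne]
        · simp
        · simp [Fin.ext_iff]
      rw [t0, t1, t2, hsymm]
    · rw [iteratedFDeriv_succ_apply_left, iteratedFDeriv_succ_apply_left]
      have t0 : (v ∘ Equiv.swap (Fin.castSucc j.succ) (Fin.succ j.succ)) 0 = v 0 := by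
        simp only [Function.comp]
        rw [Equiv.swap_apply_of_ne_of_ne] <;> simp [Fin.ext_iff]
      have t1 : Fin.tail (v ∘ Equiv.swap (Fin.castSucc j.succ) (Fin.succ j.succ)) =
          Fin.tail v ∘ Equiv.swap j.castSucc j.succ := by
        funext s
        simp only [Fin.tail, Function.comp]
        rw [← Fin.succ_castSucc, Function.Injective.swap_apply (Fin.succ_injective _)]
      rw [t0, t1]
      have e1 := hder (m + 1) z hz (Fin.tail v ∘ Equiv.swap j.castSucc j.succ)
      have e2 := hder (m + 1) z hz (Fin.tail v)
      have e3 := e2.congr_of_eventuallyEq ((hU.eventually_mem hz).mono fun y hy =>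
        ih y hy j (Fin.tail v))
      exact congrArg (fun L => L (v 0)) (e1.unique e3)

/-- The iterated derivatives of a smooth function are symmetric. -/
lemma ContDiffOn.iteratedFDeriv_comp_perm {U : Set E} (hU : IsOpen U) {f : E → F}
    (hf : ContDiffOn ℝ ∞ f U) {m : ℕ} {z : E} (hz : z ∈ U) (v : Fin m → E)
    (σ : Equiv.Perm (Fin m)) :
    iteratedFDeriv ℝ m f z (v ∘ σ) = iteratedFDeriv ℝ m f z v := by
  rcases m with _ | m
  · congr 1; ext i; exact i.elim0
  · have hσ : σ ∈ Submonoid.closure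
        (Set.range fun i : Fin m => Equiv.swap i.castSucc i.succ) := by
      rw [Equiv.Perm.mclosure_swap_castSucc_succ]; trivial
    revert v
    induction hσ using Submonoid.closure_induction with
    | mem _ h =>
      obtain ⟨i, rfl⟩ := h
      exact fun v => hf.iteratedFDeriv_comp_swap hU m z hz i v
    | one => intro v; rfl
    | mul a b _ _ ha hb =>
      intro v
      rw [Equiv.Perm.coe_mul, ← Function.comp_assoc, hb, ha]

end Symmetry

/-! ### Derivative bounds -/

/-- `f` is smooth on `U` and its derivatives there of every order `m ≤ β` are at most `m! c^m` in
operator norm. No bound is asked for beyond the order `β`: a mild function satisfies this with a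
constant `c` that grows with `β`. -/
structure DerivBound {E : Type*} [NormedAddCommGroup E] [NormedSpace ℝ E] (U : Set E) (β : ℕ)
    (c : ℝ) (f : E → ℝ) : Prop where
  contDiffOn : ContDiffOn ℝ ∞ f U
  norm_le : ∀ m ≤ β, ∀ z ∈ U, ‖iteratedFDerivWithin ℝ m f U z‖ ≤ m.factorial * c ^ m

namespace DerivBound

variable {E : Type*} [NormedAddCommGroup E] [NormedSpace ℝ E] {U : Set E} {β : ℕ}
  {c c' : ℝ} {f g : E → ℝ}

lemma mono (h : DerivBound U β c f) (hc : 0 ≤ c) (hcc : c ≤ c') : DerivBound U β c' f :=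
  ⟨h.contDiffOn, fun m hm z hz => (h.norm_le m hm z hz).trans (by gcongr)⟩

lemma one : DerivBound U β 0 (fun _ => (1 : ℝ)) := by
  refine ⟨contDiffOn_const, fun m _ z hz => ?_⟩
  rcases m with _ | m
  · simp
  · simp [iteratedFDerivWithin_succ_const]

/-- Leibniz' formula; the factor `s + 1` comes from `∑ i ≤ m, s ^ i ≤ (s + 1) ^ m`. -/
lemma mul {s : ℕ} (hU : UniqueDiffOn ℝ U) (hc : 0 ≤ c) (hf : DerivBound U β (s * c) f)
    (hg : DerivBound U β c g) : DerivBound U β ((s + 1 : ℕ) * c) (fun z => f z * g z) := by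
  refine ⟨hf.contDiffOn.mul hg.contDiffOn, fun m hm z hz => ?_⟩
  refine (norm_iteratedFDerivWithin_mul_le hf.contDiffOn hg.contDiffOn hU hz
    (mod_cast le_top)).trans ?_
  calc ∑ i ∈ Finset.range (m + 1), (m.choose i : ℝ) * ‖iteratedFDerivWithin ℝ i f U z‖ *
        ‖iteratedFDerivWithin ℝ (m - i) g U z‖
      ≤ ∑ i ∈ Finset.range (m + 1), (m.factorial * c ^ m) * ((s : ℝ) ^ i * m.choose i) := by
        refine Finset.sum_le_sum fun i hi => ?_
        have hi' : i ≤ m := Nat.lt_succ_iff.mp (Finset.mem_range.mp hi)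
        have hfac : ((m.choose i : ℝ) * i.factorial * (m - i).factorial) = m.factorial := by
          exact_mod_cast Nat.choose_mul_factorial_mul_factorial hi'
        have hch : (1 : ℝ) ≤ m.choose i := by exact_mod_cast Nat.choose_pos hi'
        calc _ ≤ (m.choose i : ℝ) * (i.factorial * (s * c) ^ i) *
              ((m - i).factorial * c ^ (m - i)) := by
              gcongr
              · exact hf.norm_le i (hi'.trans hm) z hz
              · exact hg.norm_le (m - i) ((Nat.sub_le _ _).trans hm) z hz
          _ = ((m.choose i : ℝ) * i.factorial * (m - i).factorial) *
              (c ^ i * c ^ (m - i)) * s ^ i := by ring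
          _ = (m.factorial * c ^ m) * ((s : ℝ) ^ i * 1) := by
              rw [hfac, ← pow_add, Nat.add_sub_cancel' hi', mul_one]
          _ ≤ _ := by gcongr
    _ = m.factorial * ((s + 1 : ℕ) * c) ^ m := by
        rw [← Finset.mul_sum, mul_pow]
        have := add_pow (s : ℝ) 1 m
        simp only [one_pow, mul_one] at this
        rw [← this]; push_cast; ring

lemma mul_pow {s : ℕ} (hU : UniqueDiffOn ℝ U) (hc : 0 ≤ c) (hf : DerivBound U β (s * c) f)
    (hg : DerivBound U β c g) (a : ℕ) :
    DerivBound U β ((s + a : ℕ) * c) (fun z => f z * g z ^ a) := by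
  induction a with
  | zero => simpa using hf
  | succ a ih =>
    have := mul hU hc ih hg
    simpa only [pow_succ, mul_assoc, add_assoc] using this

lemma prod_pow {ι : Type*} (hU : UniqueDiffOn ℝ U) (hc : 0 ≤ c) {θ : ι → E → ℝ}
    (hθ : ∀ i, DerivBound U β c (θ i)) (a : ι → ℕ) (t : Finset ι) :
    DerivBound U β ((∑ i ∈ t, a i : ℕ) * c) (fun z => ∏ i ∈ t, θ i z ^ a i) := by
  classical
  induction t using Finset.induction_on with
  | empty => simpa using one
  | insert i t hi ih =>
    have := mul_pow hU hc ih (hθ i) (a i)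
    simpa only [Finset.prod_insert hi, Finset.sum_insert hi, mul_comm, add_comm] using this

end DerivBound

/-! ### Mixed partials and the full derivative -/

/-- Expansion of a multilinear map in the standard basis. -/
lemma ContinuousMultilinearMap.apply_eq_sum_single {k m : ℕ}
    (F : ContinuousMultilinearMap ℝ (fun _ : Fin m => Fin k → ℝ) ℝ) (v : Fin m → Fin k → ℝ) :
    F v = ∑ w : Fin m → Fin k, (∏ s, v s (w s)) * F fun s => Pi.single (w s) 1 := by
  have hv : v = fun s => ∑ i : Fin k, v s i • (Pi.single i (1 : ℝ) : Fin k → ℝ) := by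
    ext s j
    simp [Finset.sum_apply, Pi.single_apply]
  conv_lhs => rw [hv]
  rw [F.map_sum]
  refine Finset.sum_congr rfl fun w _ => ?_
  rw [F.map_smul_univ]
  rfl

/-- By symmetry of higher derivatives, the derivative along any list of standard basis vectors is
the mixed partial for the multi-index counting the occurrences of each of them. -/
lemma iteratedFDeriv_single_eq_mixedPartial {k m : ℕ} {φ : (Fin k → ℝ) → ℝ} {z : Fin k → ℝ}
    {U : Set (Fin k → ℝ)} (hU : IsOpen U) (hφ : ContDiffOn ℝ ∞ φ U) (hz : z ∈ U)
    (w : Fin m → Fin k) :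
    iteratedFDeriv ℝ m φ z (fun s => Pi.single (w s) 1) =
      mixedPartial (fun i => Fintype.card {s // w s = i}) φ z := by
  have key : ∀ (m' : ℕ) (e : Fin m' ≃ Fin m),
      iteratedFDeriv ℝ m' φ z (fun s => Pi.single (w (e s)) 1) =
        iteratedFDeriv ℝ m φ z (fun s => Pi.single (w s) 1) := by
    intro m' e
    obtain rfl : m' = m := by simpa using Fintype.card_congr e
    exact hφ.iteratedFDeriv_comp_perm hU hz (fun s => Pi.single (w s) 1) e
  unfold mixedPartial
  let e : Fin (∑ i, Fintype.card {s // w s = i}) ≃ Fin m :=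
    finSigmaFinEquiv.symm.trans
      ((Equiv.sigmaCongrRight fun i => (Fintype.equivFin {s // w s = i}).symm).trans
        (Equiv.sigmaFiberEquiv w))
  rw [← key _ e]
  congr 1
  ext s : 1
  have : w (e s) = (finSigmaFinEquiv.symm s).1 :=
    ((Fintype.equivFin {s' // w s' = (finSigmaFinEquiv.symm s).1}).symm
      (finSigmaFinEquiv.symm s).2).2
  rw [this]

lemma isOpen_openUnitCube (k : ℕ) : IsOpen (openUnitCube k) :=
  isOpen_set_pi Set.finite_univ fun _ _ => isOpen_Ioo

/-- In positive dimension the first order bound forces `A` to be nonnegative. -/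
lemma IsMild.nonneg {k : ℕ} [NeZero k] {A C : ℝ} {φ : (Fin k → ℝ) → ℝ} (h : IsMild A C φ) :
    0 ≤ A := by
  have hz : (fun _ => 1 / 2 : Fin k → ℝ) ∈ openUnitCube k := by
    intro i _; norm_num
  have := (abs_nonneg _).trans (h.2 (Pi.single 0 1) _ hz)
  rw [Finset.sum_pi_single'] at this
  simp at this
  refine nonneg_of_mul_nonneg_right this ?_
  positivity

/-- Up to order `β`, the derivatives of a mild function are bounded geometrically. -/
lemma IsMild.derivBound {k : ℕ} [NeZero k] {A C : ℝ} {φ : (Fin k → ℝ) → ℝ} (h : IsMild A C φ)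
    (a c β : ℕ) (ha : A ≤ a) (hc : C ≤ c) :
    DerivBound (openUnitCube k) β (k * (a * β ^ c)) φ := by
  refine ⟨h.1, fun m hm z hz => ?_⟩
  have hA := h.nonneg
  rw [iteratedFDerivWithin_of_isOpen m (isOpen_openUnitCube k) hz]
  have hw : ∀ w : Fin m → Fin k, |iteratedFDeriv ℝ m φ z fun s => Pi.single (w s) 1| ≤
      m.factorial * (a * β ^ c : ℝ) ^ m := by
    intro w
    rw [iteratedFDeriv_single_eq_mixedPartial (isOpen_openUnitCube k) h.1 hz]
    have hsum : ∑ i, Fintype.card {s // w s = i} = m := by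
      rw [← Fintype.card_sigma, Fintype.card_congr (Equiv.sigmaFiberEquiv w), Fintype.card_fin]
    refine (h.2 _ z hz).trans ?_
    rw [hsum]
    have h1 : ((∏ i, (Fintype.card {s // w s = i}).factorial : ℕ) : ℝ) ≤ m.factorial := by
      have := Nat.le_of_dvd (Nat.factorial_pos _) (Nat.prod_factorial_dvd_factorial_sum
        Finset.univ (fun i => Fintype.card {s // w s = i}))
      rw [hsum] at this
      exact_mod_cast this
    rcases Nat.eq_zero_or_pos m with rfl | hm0
    · simp
    · have h2 : (m : ℝ) ^ C ≤ (β : ℝ) ^ c := by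
        have : (1 : ℝ) ≤ m := by exact_mod_cast hm0
        calc (m : ℝ) ^ C ≤ (m : ℝ) ^ (c : ℝ) := Real.rpow_le_rpow_of_exponent_le this hc
          _ = (m : ℝ) ^ c := Real.rpow_natCast _ _
          _ ≤ _ := by gcongr
      gcongr
  refine ContinuousMultilinearMap.opNorm_le_bound (by positivity) fun v => ?_
  rw [ContinuousMultilinearMap.apply_eq_sum_single]
  calc ‖∑ w : Fin m → Fin k, (∏ s, v s (w s)) * iteratedFDeriv ℝ m φ z fun s => Pi.single (w s) 1‖
      ≤ ∑ _w : Fin m → Fin k, (∏ s, ‖v s‖) * (m.factorial * (a * β ^ c : ℝ) ^ m) := by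
        refine (norm_sum_le _ _).trans (Finset.sum_le_sum fun w _ => ?_)
        rw [norm_mul, norm_prod]
        gcongr with s
        · exact norm_le_pi_norm _ _
        · exact hw w
    _ = _ := by
        simp only [Finset.sum_const, Finset.card_univ, Fintype.card_fun, Fintype.card_fin,
          nsmul_eq_mul]
        push_cast
        ring

/-! ### Taylor expansion -/

/-- Derivatives along a segment. -/
lemma iteratedDeriv_comp_segment {E : Type*} [NormedAddCommGroup E] [NormedSpace ℝ E] {U : Set E}
    (hU : IsOpen U) {f : E → ℝ} (hf : ContDiffOn ℝ ∞ f U) (p v : E) (m : ℕ) :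
    ∀ t : ℝ, p + t • v ∈ U →
      iteratedDeriv m (fun t : ℝ => f (p + t • v)) t =
        iteratedFDeriv ℝ m f (p + t • v) fun _ => v := by
  induction m with
  | zero => intro t _; simp
  | succ m ih =>
    intro t ht
    rw [iteratedDeriv_succ]
    have hγ : HasDerivAt (fun t : ℝ => p + t • v) v t := by
      simpa using ((hasDerivAt_id t).smul_const v).const_add p
    have hmem : ∀ᶠ t' in nhds t, p + t' • v ∈ U :=
      hγ.continuousAt.eventually_mem (hU.mem_nhds ht)
    rw [Filter.EventuallyEq.deriv_eq (hmem.mono fun t' ht' => ih t' ht')]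
    have h1 : HasDerivAt (fun t : ℝ => iteratedFDeriv ℝ m f (p + t • v))
        (fderiv ℝ (iteratedFDeriv ℝ m f) (p + t • v) v) t :=
      (hf.hasFDerivAt_iteratedFDeriv hU m ht).comp_hasDerivAt t hγ
    have h2 := ((ContinuousMultilinearMap.apply ℝ (fun _ : Fin m => E) ℝ
      (fun _ => v)).hasFDerivAt).comp_hasDerivAt t h1
    refine Eq.trans (HasDerivAt.deriv h2) ?_
    rw [iteratedFDeriv_succ_apply_left]
    rfl

/-- The Taylor polynomial of `f` at `p`, of order less than `β`, evaluated at displacement `v`. -/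
noncomputable def taylorSum {E : Type*} [NormedAddCommGroup E] [NormedSpace ℝ E] (f : E → ℝ)
    (β : ℕ) (p v : E) : ℝ :=
  ∑ m ∈ Finset.range β, (m.factorial : ℝ)⁻¹ * iteratedFDeriv ℝ m f p fun _ => v

/-- Lagrange's form of the remainder along the segment from `p` to `z`. -/
lemma DerivBound.abs_sub_taylorSum_le {E : Type*} [NormedAddCommGroup E] [NormedSpace ℝ E]
    {U : Set E} (hU : IsOpen U) (hconv : Convex ℝ U) {β : ℕ} (hβ : 1 ≤ β) {c : ℝ}
    {f : E → ℝ} (hf : DerivBound U β c f) {p z : E} (hp : p ∈ U) (hz : z ∈ U) :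
    |f z - taylorSum f β p (z - p)| ≤ (c * ‖z - p‖) ^ β := by
  obtain ⟨b, rfl⟩ : ∃ b, β = b + 1 := ⟨β - 1, by omega⟩
  set v := z - p with hv
  have hseg : ∀ t ∈ Set.Icc (0 : ℝ) 1, p + t • v ∈ U := fun t ht =>
    hconv.add_smul_sub_mem hp hz ht
  set h : ℝ → ℝ := fun t => f (p + t • v) with hh
  have hI : Set.uIcc (0 : ℝ) 1 = Set.Icc 0 1 := Set.uIcc_of_le zero_le_one
  have hcd : ∀ t ∈ Set.Icc (0 : ℝ) 1, ContDiffAt ℝ ∞ h t := fun t ht => by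
    have : ContDiffAt ℝ ∞ f (p + t • v) := hf.contDiffOn.contDiffAt (hU.mem_nhds (hseg t ht))
    exact this.comp t (by fun_prop)
  obtain ⟨x, hx, heq⟩ := taylor_mean_remainder_lagrange_iteratedDeriv (f := h) (n := b)
    (x₀ := 0) (x := 1) zero_ne_one
    (fun t ht => ((hcd t (hI ▸ ht)).of_le (by exact_mod_cast le_top)).contDiffWithinAt)
  have hx' : x ∈ Set.Icc (0 : ℝ) 1 := by
    rw [Set.uIoo_of_le zero_le_one] at hx; exact Set.Ioo_subset_Icc_self hx
  have hT : taylorWithinEval h b (Set.uIcc 0 1) 0 1 = taylorSum f (b + 1) p v := by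
    rw [taylor_within_apply, taylorSum]
    refine Finset.sum_congr rfl fun m _ => ?_
    have h0 : iteratedDerivWithin m h (Set.uIcc 0 1) 0 = iteratedFDeriv ℝ m f p fun _ => v := by
      rw [hI, iteratedDerivWithin_eq_iteratedFDerivWithin,
        iteratedFDerivWithin_eq_iteratedFDeriv (uniqueDiffOn_Icc zero_lt_one)
          ((hcd 0 (by simp)).of_le (by exact_mod_cast le_top)) (by simp),
        ← iteratedDeriv_eq_iteratedFDeriv]
      have := iteratedDeriv_comp_segment hU hf.contDiffOn p v m 0 (by simpa using hp)
      simpa using this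
    rw [h0]; simp
  have h1 : h 1 = f z := by simp [hh, hv]
  rw [hT, h1] at heq
  rw [heq, iteratedDeriv_comp_segment hU hf.contDiffOn p v (b + 1) x (hseg x hx')]
  have hb := hf.norm_le (b + 1) le_rfl _ (hseg x hx')
  rw [iteratedFDerivWithin_of_isOpen _ hU (hseg x hx')] at hb
  have hle := (iteratedFDeriv ℝ (b + 1) f (p + x • v)).le_opNorm (fun _ => v)
  have hfac : (0 : ℝ) < (b + 1).factorial := by positivity
  rw [sub_zero, one_pow, mul_one, abs_div, abs_of_pos hfac, div_le_iff₀ hfac]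
  calc _ ≤ _ := hle
    _ ≤ ((b + 1).factorial * c ^ (b + 1)) * ∏ _i : Fin (b + 1), ‖v‖ := by gcongr
    _ = _ := by simp only [Finset.prod_const, Finset.card_univ, Fintype.card_fin]; ring

/-! ### Determinants of matrices close to matrices of small rank -/

lemma Matrix.abs_det_le_factorial_mul_prod {ι : Type*} [Fintype ι] [DecidableEq ι]
    (M : Matrix ι ι ℝ) (c : ι → ℝ) (h : ∀ i j, |M i j| ≤ c j) :
    |M.det| ≤ (Fintype.card ι).factorial * ∏ j, c j := by
  rw [Matrix.det_apply]
  refine (Finset.abs_sum_le_sum_abs _ _).trans ?_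
  calc _ ≤ ∑ _σ : Equiv.Perm ι, ∏ j, c j := by
        refine Finset.sum_le_sum fun σ _ => ?_
        rw [Units.smul_def, zsmul_eq_mul, abs_mul, Finset.abs_prod]
        rw [show |(((Equiv.Perm.sign σ : ℤˣ) : ℤ) : ℝ)| = 1 by
          rcases Int.units_eq_one_or (Equiv.Perm.sign σ) with h | h <;> simp [h], one_mul]
        exact Finset.prod_le_prod (fun _ _ => abs_nonneg _) fun j _ => h _ _
    _ = _ := by simp [Fintype.card_perm]

/-- If `M` has entries at most `1` and is within `ε` of a matrix `B` of rank at most `r`, then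
after an orthogonal change of basis in the domain adapted to `ker B`, all but `r` columns of `M` are
of size `O(ε)`. -/
lemma Matrix.abs_det_le_of_rank_le {ι : Type*} [Fintype ι] [DecidableEq ι] (M B : Matrix ι ι ℝ)
    {r : ℕ} (hB : B.rank ≤ r) {ε : ℝ} (hε : 0 ≤ ε) (hε1 : ε ≤ 1) (hM : ∀ i j, |M i j| ≤ 1)
    (hMB : ∀ i j, |M i j - B i j| ≤ ε) :
    |M.det| ≤ (Fintype.card ι).factorial * (Fintype.card ι : ℝ) ^ Fintype.card ι *
      ε ^ (Fintype.card ι - r) := by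
  set N := Fintype.card ι
  let L : EuclideanSpace ℝ ι →ₗ[ℝ] (ι → ℝ) := B.mulVecLin ∘ₗ (WithLp.linearEquiv 2 ℝ (ι → ℝ))
  let W := LinearMap.ker L
  have hrank : Module.finrank ℝ (LinearMap.range L) = B.rank := by
    rw [Matrix.rank, LinearMap.range_comp_of_range_eq_top _ (LinearEquiv.range _)]
  have hsum := LinearMap.finrank_range_add_finrank_ker L
  rw [hrank, finrank_euclideanSpace] at hsum
  change B.rank + Module.finrank ℝ W = N at hsum
  obtain ⟨s, hs⟩ : ∃ s : Finset ι, s.card = Module.finrank ℝ W := by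
    obtain ⟨s, -, hs⟩ := Finset.exists_subset_card_eq (s := (Finset.univ : Finset ι))
      (n := Module.finrank ℝ W) (by rw [Finset.card_univ]; omega)
    exact ⟨s, hs⟩
  -- an orthonormal basis of the whole space whose members with index in `s` span `ker B`
  let e : s ≃ Fin (Module.finrank ℝ W) := s.equivFinOfCardEq hs
  let w := stdOrthonormalBasis ℝ W
  let u : ι → EuclideanSpace ℝ ι := fun i => if h : i ∈ s then (w (e ⟨i, h⟩) : W) else 0
  have hu : Orthonormal ℝ ((s : Set ι).domRestrict u) := by
    have h1 : Orthonormal ℝ (fun i : s => ((w (e i) : W) : EuclideanSpace ℝ ι)) :=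
      (w.orthonormal.comp e e.injective).comp_linearIsometry W.subtypeₗᵢ
    have h2 : (s : Set ι).domRestrict u =
        fun i : s => ((w (e i) : W) : EuclideanSpace ℝ ι) := by
      funext i
      have : (i : ι) ∈ s := i.2
      simp [u, Set.domRestrict, this]
    rw [h2]; exact h1
  obtain ⟨b, hb⟩ := hu.exists_orthonormalBasis_extension_of_card_eq (finrank_euclideanSpace)
  let Q : Matrix ι ι ℝ := Matrix.of fun a i => b i a
  have hQ : |Q.det| = 1 := by
    have h1 := (EuclideanSpace.basisFun ι ℝ).det_to_matrix_orthonormalBasis b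
    rw [Module.Basis.det_apply] at h1
    rw [← Real.norm_eq_abs, ← h1]
    congr 2
  have hQle : ∀ a i, |Q a i| ≤ 1 := by
    intro a i
    calc |Q a i| = ‖b i a‖ := rfl
      _ ≤ ‖b i‖ := PiLp.norm_apply_le _ _
      _ = 1 := b.orthonormal.1 i
  have hker : ∀ i ∈ s, ∀ j, ∑ a, B j a * Q a i = 0 := by
    intro i hi j
    have hmem : b i ∈ W := by
      rw [hb i hi]; simp only [u, dif_pos hi]; exact (w _).2
    have : L (b i) = 0 := hmem
    exact congrFun this j
  have hcol : ∀ j i, |(M * Q) j i| ≤ if i ∈ s then N * ε else (N : ℝ) := by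
    intro j i
    split_ifs with hi
    · have : (M * Q) j i = ∑ a, (M j a - B j a) * Q a i := by
        simp only [sub_mul, Finset.sum_sub_distrib, hker i hi j, sub_zero, Matrix.mul_apply]
      rw [this]
      refine (Finset.abs_sum_le_sum_abs _ _).trans ?_
      calc _ ≤ ∑ _a : ι, ε * 1 := by
            refine Finset.sum_le_sum fun a _ => ?_
            rw [abs_mul]
            exact mul_le_mul (hMB j a) (hQle a i) (abs_nonneg _) hε
        _ = _ := by simp [N]
    · rw [Matrix.mul_apply]
      refine (Finset.abs_sum_le_sum_abs _ _).trans ?_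
      calc _ ≤ ∑ _a : ι, (1 : ℝ) * 1 := by
            refine Finset.sum_le_sum fun a _ => ?_
            rw [abs_mul]
            exact mul_le_mul (hM j a) (hQle a i) (abs_nonneg _) zero_le_one
        _ = _ := by simp [N]
  have hdet := Matrix.abs_det_le_factorial_mul_prod (M * Q) _ hcol
  rw [Matrix.det_mul, abs_mul, hQ, mul_one] at hdet
  refine hdet.trans ?_
  have hprod : ∏ i : ι, (if i ∈ s then N * ε else (N : ℝ)) = (N : ℝ) ^ N * ε ^ s.card := by
    calc _ = ∏ i : ι, (N * if i ∈ s then ε else (1 : ℝ)) := by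
          refine Finset.prod_congr rfl fun i _ => ?_
          split_ifs <;> simp
      _ = _ := by
          rw [Finset.prod_mul_distrib, Finset.prod_const, Finset.card_univ,
            Finset.prod_ite_mem, Finset.univ_inter, Finset.prod_const]
  rw [hprod, mul_assoc]
  have := pow_le_pow_of_le_one hε hε1 (show N - r ≤ s.card by omega)
  gcongr

/-- The Taylor polynomials of order less than `β` in `k` variables span a space of dimension at
most `β ^ k`. -/
lemma rank_taylorSum_le {ι κ : Type*} [Fintype κ] {k : ℕ} (f : κ → (Fin k → ℝ) → ℝ)
    (β : ℕ) (p : Fin k → ℝ) (v : ι → Fin k → ℝ) :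
    (Matrix.of fun i a => taylorSum (f a) β p (v i)).rank ≤ β ^ k := by
  classical
  -- the multi-index of a word in the basis vectors
  let μ : (m : ℕ) → m ∈ Finset.range β → (Fin m → Fin k) → Fin k → Fin β := fun m hm w i =>
    ⟨Fintype.card {s // w s = i}, lt_of_le_of_lt
      ((Fintype.card_subtype_le _).trans_eq (Fintype.card_fin m)) (Finset.mem_range.mp hm)⟩
  let P : Matrix ι (Fin k → Fin β) ℝ := Matrix.of fun i ν => ∏ j, v i j ^ (ν j : ℕ)
  let R : Matrix (Fin k → Fin β) κ ℝ := Matrix.of fun ν a =>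
    ∑ m ∈ (Finset.range β).attach, ∑ w : Fin m.1 → Fin k,
      if μ m.1 m.2 w = ν then
        ((m.1).factorial : ℝ)⁻¹ * iteratedFDeriv ℝ m.1 (f a) p fun s => Pi.single (w s) 1
      else 0
  have hPR : (Matrix.of fun i a => taylorSum (f a) β p (v i)) = P * R := by
    ext i a
    simp only [Matrix.of_apply, Matrix.mul_apply, P, R, taylorSum, Finset.mul_sum]
    rw [Finset.sum_comm, ← Finset.sum_attach]
    refine Finset.sum_congr rfl fun m _ => ?_
    rw [Finset.sum_comm, ContinuousMultilinearMap.apply_eq_sum_single, Finset.mul_sum]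
    refine Finset.sum_congr rfl fun w _ => ?_
    simp only [mul_ite, mul_zero, Finset.sum_ite_eq, Finset.mem_univ, if_true]
    have : ∏ s, v i (w s) = ∏ j, v i j ^ (μ m.1 m.2 w j : ℕ) := by
      rw [← Finset.prod_fiberwise (s := Finset.univ) (g := w)]
      refine Finset.prod_congr rfl fun j _ => ?_
      rw [Finset.prod_congr rfl (g := fun _ => v i j) (fun s hs => by
        rw [(Finset.mem_filter.mp hs).2]), Finset.prod_const]
      simp only [μ, Fintype.card_subtype]
    rw [this]; ring
  rw [hPR]
  refine (Matrix.rank_mul_le_left _ _).trans ((Matrix.rank_le_card_width _).trans_eq ?_)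
  simp

/-! ### Heights of determinants -/

open Height Height.AdmissibleAbsValues in
/-- A product of local bounds gives a bound for the height. -/
lemma Height.mulHeight₁_le_of_forall_le {K : Type*} [Field K] [AdmissibleAbsValues K] {y : K}
    {c : ℝ} (hc : 1 ≤ c) {ι : Type*} (s : Finset ι) (u : ι → K)
    (harch : ∀ v ∈ (archAbsVal : Multiset (AbsoluteValue K ℝ)),
      v y ≤ c * ∏ l ∈ s, max (v (u l)) 1)
    (hnon : ∀ v ∈ (nonarchAbsVal : Set (AbsoluteValue K ℝ)), v y ≤ ∏ l ∈ s, max (v (u l)) 1) :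
    mulHeight₁ y ≤ c ^ totalWeight K * ∏ l ∈ s, mulHeight₁ (u l) := by
  have hfin : ∀ x : K, (fun v : (nonarchAbsVal : Set (AbsoluteValue K ℝ)) =>
      max (v.val x) 1).HasFiniteMulSupport := fun x => by
    rcases eq_or_ne x 0 with rfl | hx
    · simp [Function.HasFiniteMulSupport]
    · exact (hasFiniteMulSupport hx).subset fun v hv => by
        simp only [Function.mem_mulSupport] at hv ⊢
        intro h; simp [h] at hv
  have hone : ∀ v : AbsoluteValue K ℝ, 1 ≤ ∏ l ∈ s, max (v (u l)) 1 := fun v =>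
    Finset.one_le_prod fun _ _ => le_max_right _ _
  simp only [mulHeight₁_eq, totalWeight]
  rw [Finset.prod_mul_distrib, ← Multiset.prod_replicate, ← Multiset.map_const,
    ← finprod_prod_comm _ _ (fun l _ => hfin (u l)), ← Multiset.prod_map_prod, ← mul_assoc,
    ← Multiset.prod_map_mul]
  simp only [Function.const_apply]
  gcongr
  · exact finprod_nonneg fun _ => by positivity
  · exact Multiset.prod_map_nonneg fun _ h => by positivity
  · refine Multiset.prod_map_le_prod_map₀ _ _ (fun _ _ => by positivity) fun v hv =>
      max_le (harch v hv) ?_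
    nlinarith [hone v]
  · refine finprod_le_finprod (hfin y) (fun _ => by positivity) ?_ fun v =>
      max_le (hnon v v.2) (hone v)
    fun_prop (disch := exact hfin _)

open Height Height.AdmissibleAbsValues in
/-- The height of a determinant whose rows are dominated at every place by the heights of points
`x i`: each term of the Leibniz expansion is dominated by the same product over all rows, so the
factorial enters only at the archimedean places. -/
lemma Height.mulHeight₁_det_le {K : Type*} [Field K] [AdmissibleAbsValues K] {ι κ : Type*}
    [Fintype ι] [DecidableEq ι] [Fintype κ] (M : Matrix ι ι K) (x : ι → κ → K) (D : ℕ)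
    (hM : ∀ (v : AbsoluteValue K ℝ) (i a : ι), v (M i a) ≤ ∏ j, max (v (x i j)) 1 ^ D) :
    mulHeight₁ M.det ≤ ((Fintype.card ι).factorial : ℝ) ^ totalWeight K *
      ∏ i, ∏ j, mulHeight₁ (x i j) ^ D := by
  have hterm : ∀ (v : AbsoluteValue K ℝ) (σ : Equiv.Perm ι),
      v (Equiv.Perm.sign σ • ∏ i, M.transpose (σ i) i) ≤
        ∏ l ∈ (Finset.univ : Finset ((ι × κ) × Fin D)), max (v (x l.1.1 l.1.2)) 1 := by
    intro v σ
    have h1 : v (Equiv.Perm.sign σ • ∏ i, M.transpose (σ i) i) = ∏ i, v (M i (σ i)) := by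
      rw [Units.smul_def]
      rcases Int.units_eq_one_or (Equiv.Perm.sign σ) with h | h <;>
        simp [h, map_prod, Matrix.transpose_apply]
    rw [h1]
    calc ∏ i, v (M i (σ i)) ≤ ∏ i, ∏ j, max (v (x i j)) 1 ^ D :=
          Finset.prod_le_prod (fun _ _ => v.nonneg _) fun i _ => hM v i _
      _ = _ := by simp [Fintype.prod_prod_type]
  have := Height.mulHeight₁_le_of_forall_le (y := M.det)
    (c := (Fintype.card ι).factorial) (by exact_mod_cast Nat.factorial_pos _)
    (Finset.univ : Finset ((ι × κ) × Fin D)) (fun l => x l.1.1 l.1.2)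
    (fun v _ => by
      rw [← Matrix.det_transpose, Matrix.det_apply]
      refine (v.sum_le _ _).trans ?_
      refine (Finset.sum_le_sum fun σ _ => hterm v σ).trans_eq ?_
      simp [Fintype.card_perm])
    (fun v hv => by
      rw [← Matrix.det_transpose, Matrix.det_apply]
      refine ((isNonarchimedean v hv).apply_sum_le_sup Finset.univ_nonempty).trans ?_
      exact Finset.sup'_le _ _ fun σ _ => hterm v σ)
  simpa [Fintype.prod_prod_type] using this

/-- Liouville's inequality: apply `‖φ x‖ ≤ H(x)` to `x = y⁻¹`, which has the height of `y`. -/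
lemma NumberField.inv_mulHeight₁_le_norm {K : Type*} [Field K] [NumberField K] (φ : K →+* ℂ)
    {y : K} (hy : y ≠ 0) : (Height.mulHeight₁ y)⁻¹ ≤ ‖φ y‖ := by
  have key : ∀ x : K, ‖φ x‖ ≤ Height.mulHeight₁ x := by
    intro x
    rw [NumberField.mulHeight₁_eq]
    have h1 : ∀ v : InfinitePlace K, 1 ≤ max (v x) 1 ^ v.mult := fun v =>
      one_le_pow₀ (le_max_right _ _)
    have h2 : 1 ≤ ∏ᶠ v : FinitePlace K, max (v x) 1 := one_le_finprod fun _ => le_max_right _ _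
    have h3 : ‖φ x‖ ≤ max (InfinitePlace.mk φ x) 1 ^ (InfinitePlace.mk φ).mult := by
      refine le_trans ?_ (le_self_pow₀ (le_max_right _ _) (InfinitePlace.mult_ne_zero))
      rw [InfinitePlace.apply]; exact le_max_left _ _
    calc ‖φ x‖ ≤ _ := h3
      _ ≤ ∏ v : InfinitePlace K, max (v x) 1 ^ v.mult := by
          classical
          rw [← Finset.mul_prod_erase _ _ (Finset.mem_univ (InfinitePlace.mk φ))]
          exact le_mul_of_one_le_right (by positivity) (Finset.one_le_prod fun v _ => h1 v)
      _ ≤ _ := le_mul_of_one_le_right (zero_le_one.trans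
          (Finset.one_le_prod fun v _ => h1 v)) h2
  have := key y⁻¹
  rw [Height.mulHeight₁_inv, map_inv₀, norm_inv] at this
  have hpos : 0 < ‖φ y‖ := norm_pos_iff.2 ((map_ne_zero φ).2 hy)
  exact inv_le_of_inv_le₀ hpos this

/-! ### Interpolation by polynomials of bounded degree -/

/-- Exponents of the monomials of degree at most `D` in `n` variables. -/
abbrev MonomialIndex (n D : ℕ) : Type :=
  {α : Fin n → Fin (D + 1) // ∑ j, (α j : ℕ) ≤ D}

namespace MonomialIndex

variable {n D : ℕ}

lemma card_le : Fintype.card (MonomialIndex n D) ≤ (D + 1) ^ n := by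
  refine (Fintype.card_subtype_le _).trans_eq ?_
  simp

lemma two_le_card (hn : 0 < n) (hD : 1 ≤ D) : 2 ≤ Fintype.card (MonomialIndex n D) := by
  refine Fintype.one_lt_card_iff.2 ⟨⟨fun _ => 0, by simp⟩,
    ⟨Pi.single ⟨0, hn⟩ ⟨1, by omega⟩, ?_⟩, fun h => ?_⟩
  · rw [Finset.sum_eq_single ⟨0, hn⟩]
    · simpa using hD
    · intro b _ hb; simp [hb]
    · simp
  · have := congrFun (Subtype.ext_iff.1 h) ⟨0, hn⟩
    simp [Fin.ext_iff] at this

/-- The monomials with all exponents at most `D / n` have degree at most `D`. -/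
lemma pow_le_mul_card (hn : 0 < n) : (D + 1) ^ n ≤ n ^ n * Fintype.card (MonomialIndex n D) := by
  have h1 : (D / n + 1) ^ n ≤ Fintype.card (MonomialIndex n D) := by
    have hle : ∀ α : Fin n → Fin (D / n + 1), ∀ j, (α j : ℕ) ≤ D / n := fun α j =>
      Nat.lt_succ_iff.mp (α j).2
    have := Fintype.card_le_of_injective
      (fun α : Fin n → Fin (D / n + 1) => (⟨fun j => ⟨α j,
        Nat.lt_succ_iff.mpr ((hle α j).trans (Nat.div_le_self _ _))⟩, by
          calc ∑ j, (α j : ℕ) ≤ ∑ _j : Fin n, D / n := Finset.sum_le_sum fun j _ => hle α j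
            _ = n * (D / n) := by simp
            _ ≤ D := Nat.mul_div_le _ _⟩ : MonomialIndex n D))
      (fun α γ h => by
        funext j
        have := congrFun (Subtype.ext_iff.1 h) j
        simpa [Fin.ext_iff] using this)
    simpa using this
  calc (D + 1) ^ n ≤ (n * (D / n + 1)) ^ n :=
        Nat.pow_le_pow_left (Nat.lt_mul_div_succ D hn) n
    _ = n ^ n * (D / n + 1) ^ n := mul_pow _ _ _
    _ ≤ _ := Nat.mul_le_mul_left _ h1

end MonomialIndex

/-- If all interpolation determinants on `S` vanish, then `S` lies on a hypersurface. -/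
lemma exists_mvPolynomial_of_det_eq_zero {n D : ℕ} (S : Set (Fin n → ℝ))
    (h : ∀ x : MonomialIndex n D → Fin n → ℝ, (∀ i, x i ∈ S) →
      (Matrix.of fun i α : MonomialIndex n D => ∏ j, x i j ^ (α.1 j : ℕ)).det = 0) :
    ∃ P : MvPolynomial (Fin n) ℝ, P ≠ 0 ∧ P.totalDegree ≤ D ∧
      ∀ p ∈ S, MvPolynomial.eval p P = 0 := by
  classical
  let ev : (Fin n → ℝ) → MonomialIndex n D → ℝ := fun p α => ∏ j, p j ^ (α.1 j : ℕ)
  have hne : Submodule.span ℝ (ev '' S) < ⊤ := by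
    refine lt_top_iff_ne_top.2 fun htop => ?_
    obtain ⟨b, hbS, hspan, hli⟩ := exists_linearIndependent ℝ (ev '' S)
    rw [htop] at hspan
    let B := Module.Basis.mk hli (by rw [Subtype.range_coe, hspan])
    let e : MonomialIndex n D ≃ b := (Pi.basisFun ℝ (MonomialIndex n D)).indexEquiv B
    have hx : ∀ i : MonomialIndex n D, ∃ p ∈ S, ev p = 
        (e i : MonomialIndex n D → ℝ) := fun i => hbS (e i).2
    choose x hxS hx using hx
    have hli' : LinearIndependent ℝ
        (Matrix.of fun i α : MonomialIndex n D => ∏ j, x i j ^ (α.1 j : ℕ)).row := by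
      have h1 : (Matrix.of fun i α : MonomialIndex n D => ∏ j, x i j ^ (α.1 j : ℕ)).row =
          (fun y : b => (y : MonomialIndex n D → ℝ)) ∘ e := by
        funext i
        exact hx i
      rw [h1]
      exact hli.comp _ e.injective
    have hunit := Matrix.linearIndependent_rows_iff_isUnit.1 hli'
    rw [Matrix.isUnit_iff_isUnit_det, h x hxS] at hunit
    exact not_isUnit_zero hunit
  -- the coefficients of the polynomial form a linear functional that kills all vectors `(p ^ α)_α`
  obtain ⟨f, hf0, hf⟩ := Submodule.exists_le_ker_of_lt_top _ hne
  let ex : MonomialIndex n D → (Fin n →₀ ℕ) := fun α =>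
    Finsupp.equivFunOnFinite.symm fun j => (α.1 j : ℕ)
  have hex : Function.Injective ex := fun α γ hαγ => by
    ext j
    simpa [ex] using DFunLike.congr_fun hαγ j
  let P : MvPolynomial (Fin n) ℝ :=
    ∑ α : MonomialIndex n D, MvPolynomial.monomial (ex α) (f (Pi.single α 1))
  refine ⟨P, ?_, ?_, fun p hp => ?_⟩
  · intro hP
    refine hf0 (LinearMap.pi_ext' fun α => LinearMap.ext_ring ?_)
    have := congrArg (MvPolynomial.coeff (ex α)) hP
    simpa [P, MvPolynomial.coeff_sum, MvPolynomial.coeff_monomial, hex.eq_iff,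
      Finset.sum_ite_eq'] using this
  · refine MvPolynomial.totalDegree_finsetSum_le fun α _ => ?_
    refine (MvPolynomial.totalDegree_monomial_le _ _).trans ?_
    rw [Finsupp.sum_fintype _ _ (fun _ => rfl)]
    exact α.2
  · have h0 : f (ev p) = 0 := hf (Submodule.subset_span ⟨p, hp, rfl⟩)
    have hev : ev p =
        ∑ α : MonomialIndex n D, ev p α • (Pi.single α (1 : ℝ) : MonomialIndex n D → ℝ) := by
      ext γ
      simp [Finset.sum_apply, Pi.single_apply]
    rw [hev, map_sum] at h0
    rw [map_sum, ← h0]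
    refine Finset.sum_congr rfl fun α _ => ?_
    rw [MvPolynomial.eval_monomial, map_smul, smul_eq_mul, mul_comm,
      Finsupp.prod_fintype _ _ (fun _ => pow_zero _)]
    rfl

/-- A polynomial vanishing on a nonempty set is either zero or nonconstant, so that finitely many
nonzero polynomials yield a covering by hypersurfaces. -/
lemma exists_finite_cover_hypersurfaces {n : ℕ} {I : Type*} [Fintype I] {Y : Set (Fin n → ℝ)}
    (S : I → Set (Fin n → ℝ)) (hY : Y ⊆ ⋃ i, S i) (D : ℝ)
    (hS : ∀ i, ∃ P : MvPolynomial (Fin n) ℝ, P ≠ 0 ∧ (P.totalDegree : ℝ) ≤ D ∧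
      ∀ p ∈ S i, MvPolynomial.eval p P = 0) :
    ∃ Z : Set (Set (Fin n → ℝ)), Z.Finite ∧ Z.ncard ≤ Fintype.card I ∧
      (∀ z ∈ Z, IsHypersurfaceOfDegreeLE D z) ∧ Y ⊆ ⋃₀ Z := by
  classical
  choose P hP0 hPD hP using hS
  let z : I → Set (Fin n → ℝ) := fun i => {x | MvPolynomial.eval x (P i) = 0}
  refine ⟨z '' {i | (S i).Nonempty}, Set.toFinite _, ?_, ?_, ?_⟩
  · refine (Set.ncard_image_le (Set.toFinite _)).trans ?_
    rw [← Nat.card_eq_fintype_card]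
    exact Set.ncard_le_card _
  · rintro _ ⟨i, ⟨p, hp⟩, rfl⟩
    refine ⟨P i, Nat.pos_of_ne_zero fun h0 => ?_, hPD i, rfl⟩
    have h1 := MvPolynomial.totalDegree_eq_zero_iff_eq_C.1 h0
    have h2 := hP i p hp
    rw [h1, MvPolynomial.eval_C] at h2
    rw [h2, map_zero] at h1
    exact hP0 i h1
  · intro y hy
    obtain ⟨i, hi⟩ := Set.mem_iUnion.1 (hY hy)
    exact ⟨z i, ⟨i, ⟨y, hi⟩, rfl⟩, hP i y hi⟩

/-! ### Vanishing of interpolation determinants -/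

lemma convex_openUnitCube (k : ℕ) : Convex ℝ (openUnitCube k) :=
  convex_pi fun _ _ => convex_Ioo 0 1

/-- Upper bound for the interpolation determinant of points with nearby parameters. -/
lemma abs_det_monomials_le {k n D β : ℕ} (hβ : 1 ≤ β) {θ : Fin n → (Fin k → ℝ) → ℝ} {c r : ℝ}
    (hc : 0 ≤ c) (hr : 0 ≤ r) (hθ : ∀ j, DerivBound (openUnitCube k) β c (θ j))
    {p : Fin k → ℝ} (hp : p ∈ openUnitCube k) (z : MonomialIndex n D → Fin k → ℝ)
    (hz : ∀ i, z i ∈ openUnitCube k) (hzp : ∀ i, ‖z i - p‖ ≤ r) (hρ : D * c * r ≤ 1) :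
    |(Matrix.of fun i α : MonomialIndex n D => ∏ j, θ j (z i) ^ (α.1 j : ℕ)).det| ≤
      (Fintype.card (MonomialIndex n D)).factorial *
        (Fintype.card (MonomialIndex n D) : ℝ) ^ Fintype.card (MonomialIndex n D) *
          ((D * c * r) ^ β) ^ (Fintype.card (MonomialIndex n D) - β ^ k) := by
  have hU := isOpen_openUnitCube k
  let f : MonomialIndex n D → (Fin k → ℝ) → ℝ := fun α y => ∏ j, θ j y ^ (α.1 j : ℕ)
  have hf : ∀ α, DerivBound (openUnitCube k) β (D * c) (f α) := fun α =>
    (DerivBound.prod_pow hU.uniqueDiffOn hc hθ (fun j => (α.1 j : ℕ)) Finset.univ).mono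
      (by positivity) (by
        have : ((∑ j, (α.1 j : ℕ) : ℕ) : ℝ) ≤ D := by exact_mod_cast α.2
        gcongr)
  refine Matrix.abs_det_le_of_rank_le _
    (Matrix.of fun i α => taylorSum (f α) β p (z i - p)) (rank_taylorSum_le f β p _)
    (by positivity) (pow_le_one₀ (by positivity) hρ) (fun i α => ?_) (fun i α => ?_)
  · have := (hf α).norm_le 0 (Nat.zero_le _) _ (hz i)
    simpa [norm_iteratedFDerivWithin_zero] using this
  · refine ((hf α).abs_sub_taylorSum_le hU (convex_openUnitCube k) hβ hp (hz i)).trans ?_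
    have := hzp i
    gcongr

lemma mulHeight₁_le_pow_of_absWeilHeight_le {K : Type*} [Field K] [NumberField K] {a : K} {T : ℝ}
    (h : absWeilHeight a ≤ T) : Height.mulHeight₁ a ≤ T ^ Module.finrank ℚ K := by
  have hd : (Module.finrank ℚ K : ℝ) ≠ 0 := by
    exact_mod_cast (Module.finrank_pos (R := ℚ) (M := K)).ne'
  have h0 := Height.mulHeight₁_nonneg a
  have h1 : 0 ≤ absWeilHeight a := Real.rpow_nonneg h0 _
  calc Height.mulHeight₁ a = absWeilHeight a ^ Module.finrank ℚ K := by
        rw [absWeilHeight, ← Real.rpow_natCast, ← Real.rpow_mul h0, one_div,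
          inv_mul_cancel₀ hd, Real.rpow_one]
    _ ≤ _ := by gcongr

/-- Lower bound for a nonzero interpolation determinant of points of bounded height. -/
lemma one_le_abs_det_mul {n D : ℕ} (K : Subfield ℂ) [NumberField K] {T : ℝ}
    (x : MonomialIndex n D → Fin n → ℝ)
    (hx : ∀ i j, ∃ a : K, (a : ℂ) = ((x i j : ℝ) : ℂ) ∧ absWeilHeight a ≤ T)
    (hdet : (Matrix.of fun i α : MonomialIndex n D => ∏ j, x i j ^ (α.1 j : ℕ)).det ≠ 0) :
    1 ≤ |(Matrix.of fun i α : MonomialIndex n D => ∏ j, x i j ^ (α.1 j : ℕ)).det| *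
      (((Fintype.card (MonomialIndex n D)).factorial : ℝ) ^ Module.finrank ℚ K *
        T ^ (Module.finrank ℚ K * (n * D * Fintype.card (MonomialIndex n D)))) := by
  choose a ha hT using hx
  set d := Module.finrank ℚ K
  set A : Matrix (MonomialIndex n D) (MonomialIndex n D) K :=
    Matrix.of fun i α => ∏ j, a i j ^ (α.1 j : ℕ)
  set X := Matrix.of fun i α : MonomialIndex n D => ∏ j, x i j ^ (α.1 j : ℕ)
  have hAX : ((A.det : K) : ℂ) = ((X.det : ℝ) : ℂ) := by
    have h1 : ((A.det : K) : ℂ) = (A.map K.subtype).det := RingHom.map_det K.subtype A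
    have h2 : ((X.det : ℝ) : ℂ) = (X.map Complex.ofRealHom).det :=
      RingHom.map_det Complex.ofRealHom X
    rw [h1, h2]
    congr 1
    ext i α
    simp [A, X, ha]
  have hA0 : A.det ≠ 0 := fun h => hdet (by
    rw [h] at hAX; exact Complex.ofReal_eq_zero.1 hAX.symm)
  have hlow := NumberField.inv_mulHeight₁_le_norm K.subtype hA0
  have hnorm : ‖K.subtype A.det‖ = |X.det| := by
    change ‖((A.det : K) : ℂ)‖ = _
    rw [hAX, Complex.norm_real, Real.norm_eq_abs]
  rw [hnorm] at hlow
  have hup := Height.mulHeight₁_det_le A a D fun v i α => by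
    simp only [A, Matrix.of_apply, map_prod, map_pow]
    refine Finset.prod_le_prod (fun _ _ => by positivity) fun j _ => ?_
    calc v (a i j) ^ (α.1 j : ℕ) ≤ max (v (a i j)) 1 ^ (α.1 j : ℕ) := by
          gcongr; exact le_max_left _ _
      _ ≤ _ := pow_le_pow_right₀ (le_max_right _ _) (Nat.lt_succ_iff.mp (α.1 j).2)
  rw [NumberField.totalWeight_eq_finrank] at hup
  have hprod : ∏ i, ∏ j, Height.mulHeight₁ (a i j) ^ D ≤
      T ^ (d * (n * D * Fintype.card (MonomialIndex n D))) := by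
    calc _ ≤ ∏ _i : MonomialIndex n D, ∏ _j : Fin n, (T ^ d) ^ D := by
          gcongr with i _ j _
          exact mulHeight₁_le_pow_of_absWeilHeight_le (hT i j)
      _ = _ := by
          simp only [Finset.prod_const, Finset.card_univ, Fintype.card_fin, ← pow_mul]
          congr 1; ring
  have hH := Height.mulHeight₁_pos A.det
  calc (1 : ℝ) = (Height.mulHeight₁ A.det)⁻¹ * Height.mulHeight₁ A.det :=
        (inv_mul_cancel₀ hH.ne').symm
    _ ≤ |X.det| * Height.mulHeight₁ A.det := by gcongr
    _ ≤ _ := by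
        refine mul_le_mul_of_nonneg_left (hup.trans ?_) (abs_nonneg _)
        gcongr

/-- The comparison of the upper and the lower bound: with `log N ≤ n D` and `1 ≤ log T`, the
logarithm of the left side is at most `4 d n D N log T - (N / 2) q β`. -/
lemma upper_lower_bound_lt_one {N n D d m β c : ℕ} {T ρ : ℝ} (hT : Real.exp 1 ≤ T) (hn : 1 ≤ n)
    (hd : 1 ≤ d) (hN : 1 ≤ N) (hND : N ≤ (D + 1) ^ n) (hm : 2 * m ≤ N)
    (hc : (D + 1) * (d ^ 2 * Real.log T) ≤ c * β) (hρ0 : 0 ≤ ρ)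
    (hρ : ρ ≤ Real.exp (-(8 * n * c))) :
    ((N.factorial : ℝ) * (N : ℝ) ^ N * (ρ ^ β) ^ (N - m)) *
      ((N.factorial : ℝ) ^ d * T ^ (d * (n * D * N))) < 1 := by
  have hT0 : 0 < T := (Real.exp_pos 1).trans_le hT
  have hlogT : 1 ≤ Real.log T := (Real.le_log_iff_exp_le hT0).2 hT
  have hN0 : (0 : ℝ) < N := by exact_mod_cast hN
  set l := Real.log N with hl
  have hNexp : (N : ℝ) = Real.exp l := (Real.exp_log hN0).symm
  have hTexp : T = Real.exp (Real.log T) := (Real.exp_log hT0).symm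
  set t := Real.log T with ht
  have hfac : (N.factorial : ℝ) ≤ Real.exp (N * l) := by
    calc (N.factorial : ℝ) ≤ (N : ℝ) ^ N := by exact_mod_cast Nat.factorial_le_pow N
      _ = _ := by rw [hNexp, ← Real.exp_nat_mul, ← hNexp]
  have hlD : l ≤ n * D := by
    have h1 : (N : ℝ) ≤ ((D : ℝ) + 1) ^ n := by exact_mod_cast hND
    calc l ≤ Real.log (((D : ℝ) + 1) ^ n) := Real.log_le_log hN0 h1
      _ = n * Real.log (D + 1) := Real.log_pow _ _
      _ ≤ _ := by
        gcongr
        have := Real.log_le_sub_one_of_pos (show (0 : ℝ) < D + 1 by positivity)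
        linarith
  have hl0 : 0 ≤ l := Real.log_nonneg (by exact_mod_cast hN)
  have hsub : (N : ℝ) / 2 ≤ ((N - m : ℕ) : ℝ) := by
    rw [Nat.cast_sub (by omega)]
    have : (2 : ℝ) * m ≤ N := by exact_mod_cast hm
    linarith
  have hd' : (1 : ℝ) ≤ d := by exact_mod_cast hd
  have hn' : (1 : ℝ) ≤ n := by exact_mod_cast hn
  calc _ ≤ (Real.exp (N * l) * Real.exp (N * l) *
          (Real.exp (-(8 * n * c)) ^ β) ^ (N - m)) *
        (Real.exp (N * l) ^ d * T ^ (d * (n * D * N))) := by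
        have : (N : ℝ) ^ N = Real.exp (N * l) := by
          rw [hNexp, ← Real.exp_nat_mul, ← hNexp]
        rw [this]
        gcongr
    _ = Real.exp (N * l + N * l + ((N - m : ℕ) : ℝ) * (β * (-(8 * n * c))) +
          (d * (N * l) + ((d * (n * D * N) : ℕ) : ℝ) * t)) := by
        conv_lhs => rw [hTexp]
        simp only [Real.exp_add, Real.exp_nat_mul]
    _ < 1 := by
        rw [Real.exp_lt_one_iff]
        push_cast
        have h1 : ((N - m : ℕ) : ℝ) * (β * (8 * n * c)) ≥ N / 2 * (β * (8 * n * c)) := by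
          gcongr
        have h2 : (n : ℝ) * ((D + 1) * (d ^ 2 * t)) ≤ n * (c * β) := by gcongr
        have h3 : (d : ℝ) + 2 ≤ 3 * d := by linarith
        have h4 : ((d : ℝ) + 2) * l ≤ 3 * d * (n * D) := by gcongr
        have h5 : 3 * d * (n * D : ℝ) ≤ 3 * d * (n * D) * t :=
          le_mul_of_one_le_right (by positivity) hlogT
        have h6 : (d : ℝ) * (n * D * t) ≤ d ^ 2 * (n * D * t) := by
          gcongr; nlinarith
        have h7 : (0 : ℝ) < n * (d ^ 2 * t) := by positivity
        have h8 : ((d : ℝ) + 2) * l + d * n * D * t < 4 * (n * (c * β)) := by nlinarith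
        have h9 : N * (((d : ℝ) + 2) * l + d * n * D * t) < N * (4 * (n * (c * β))) := by gcongr
        nlinarith

/-! ### Choice of the parameters -/

/-- With `D = ⌊Q ^ (k / (n - k))⌋`, the order `β` of the Taylor expansion is the largest one for
which polynomials of order `β` in `k` variables take up at most half of the dimension of the space
of polynomials of degree `D` in `n` variables. -/
lemma exists_taylor_order {n k : ℕ} (hk : 0 < k) (hkn : k < n) {Q : ℝ} (hQ : 1 ≤ Q) {D : ℕ}
    (hD : D = ⌊Q ^ ((k : ℝ) / ((n : ℝ) - (k : ℝ)))⌋₊) :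
    1 ≤ D ∧ (D : ℝ) ≤ Q ^ k ∧ ∃ β : ℕ, 1 ≤ β ∧
      2 * β ^ k ≤ Fintype.card (MonomialIndex n D) ∧
      (D + 1) * Q ≤ (2 ^ (k + 1) * n ^ n : ℕ) * (β : ℝ) ∧ (β : ℝ) ≤ 2 ^ n * Q ^ (k * n) := by
  have hnk : (1 : ℝ) ≤ (n : ℝ) - k := by
    have : (k : ℝ) + 1 ≤ n := by exact_mod_cast hkn
    linarith
  have hQ0 : 0 ≤ Q := zero_le_one.trans hQ
  set Y := Q ^ ((k : ℝ) / ((n : ℝ) - (k : ℝ))) with hY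
  have hY1 : 1 ≤ Y := Real.one_le_rpow hQ (by positivity)
  have hD1 : 1 ≤ D := by rw [hD]; exact Nat.le_floor (by simpa using hY1)
  have hDY : (D : ℝ) ≤ Y := by rw [hD]; exact Nat.floor_le (by linarith)
  have hYD : Y ≤ D + 1 := by rw [hD]; exact (Nat.lt_floor_add_one Y).le
  have hYk : Y ≤ Q ^ k := by
    rw [← Real.rpow_natCast]
    exact Real.rpow_le_rpow_of_exponent_le hQ (div_le_self (by positivity) hnk)
  have hDk : (D : ℝ) ≤ Q ^ k := hDY.trans hYk
  refine ⟨hD1, hDk, ?_⟩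
  have hn : 0 < n := by omega
  set N := Fintype.card (MonomialIndex n D)
  have hN2 : 2 ≤ N := MonomialIndex.two_le_card hn hD1
  have hNle : N ≤ (D + 1) ^ n := MonomialIndex.card_le
  have hNge : (D + 1) ^ n ≤ n ^ n * N := MonomialIndex.pow_le_mul_card hn
  set β := Nat.findGreatest (fun b => 2 * b ^ k ≤ N) N
  have hβ1 : 1 ≤ β := Nat.le_findGreatest (by omega) (by simpa using hN2)
  have hβN : 2 * β ^ k ≤ N := Nat.findGreatest_spec (P := fun b => 2 * b ^ k ≤ N) (m := 1)
    (by omega) (by simpa using hN2)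
  have hββ : β ≤ β ^ k := Nat.le_self_pow hk.ne' _
  have hNβ : N < 2 * (β + 1) ^ k := by
    by_contra hcon
    have h1 : 2 * (β + 1) ^ k ≤ N := not_lt.1 hcon
    have h2 : β + 1 ≤ (β + 1) ^ k := Nat.le_self_pow hk.ne' _
    exact Nat.findGreatest_is_greatest (P := fun b => 2 * b ^ k ≤ N) (n := N) (k := β + 1)
      (Nat.lt_succ_self _) (by omega) h1
  refine ⟨β, hβ1, hβN, ?_, ?_⟩
  -- compare `k`-th powers, using `Q ^ k ≤ (D + 1) ^ (n - k)` and `N < 2 (2 β) ^ k`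
  · set c := 2 ^ (k + 1) * n ^ n
    have h1 : (D + 1) ^ n ≤ (c * β) ^ k := by
      calc (D + 1) ^ n ≤ n ^ n * N := hNge
        _ ≤ n ^ n * (2 * (2 * β) ^ k) := by
            have : (β + 1) ^ k ≤ (2 * β) ^ k := Nat.pow_le_pow_left (by omega) k
            gcongr; omega
        _ = c * β ^ k := by simp only [c, mul_pow]; ring
        _ ≤ c ^ k * β ^ k := by
            gcongr; exact Nat.le_self_pow hk.ne' _
        _ = _ := (mul_pow _ _ _).symm
    have h2 : Q ^ k ≤ ((D : ℝ) + 1) ^ (n - k) := by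
      have h3 : Y ^ (n - k) = Q ^ k := by
        rw [hY, ← Real.rpow_natCast, ← Real.rpow_mul hQ0, Nat.cast_sub hkn.le,
          div_mul_cancel₀ _ (by linarith), Real.rpow_natCast]
      rw [← h3]
      gcongr
    have h4 : (((D : ℝ) + 1) * Q) ^ k ≤ ((c : ℝ) * β) ^ k := by
      calc (((D : ℝ) + 1) * Q) ^ k = ((D : ℝ) + 1) ^ k * Q ^ k := mul_pow _ _ _
        _ ≤ ((D : ℝ) + 1) ^ k * ((D : ℝ) + 1) ^ (n - k) := by gcongr
        _ = ((D : ℝ) + 1) ^ n := by rw [← pow_add, Nat.add_sub_cancel' hkn.le]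
        _ ≤ _ := by exact_mod_cast h1
    exact le_of_pow_le_pow_left₀ hk.ne' (by positivity) h4
  · have h1 : (1 : ℝ) ≤ Q ^ k := one_le_pow₀ hQ
    calc (β : ℝ) ≤ ((D + 1) ^ n : ℕ) := by
          exact_mod_cast hββ.trans ((Nat.le_mul_of_pos_left _ two_pos).trans (hβN.trans hNle))
      _ = ((D : ℝ) + 1) ^ n := by push_cast; ring
      _ ≤ (2 * Q ^ k) ^ n := by gcongr; linarith
      _ = _ := by rw [mul_pow, ← pow_mul]

/-! ### Covering by hypersurfaces -/

/-- The number of subdivisions of each side of the parameter cube, for `(a, e)`-mild maps. It makes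
the ratio `ρ` in the upper bound for the determinant equal to `3 ^ (-8 n c)`, where
`c = 2 ^ (k + 1) * n ^ n` is the constant of `exists_taylor_order`. -/
def subdivisions (n k a e D β : ℕ) : ℕ :=
  D * (k * (a * β ^ e)) * 3 ^ (8 * n * (2 ^ (k + 1) * n ^ n))

/-- Points of bounded height with parameters in a common small cube lie on one hypersurface. -/
lemma exists_mvPolynomial_on_cell {n k a e D β : ℕ} (hk : 0 < k) (hn : 0 < n) (ha : 0 < a)
    (hD : 1 ≤ D) (hβ : 1 ≤ β) {θ : (Fin k → ℝ) → Fin n → ℝ}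
    (hθ : ∀ j, DerivBound (openUnitCube k) β (k * (a * β ^ e)) fun z => θ z j)
    (K : Subfield ℂ) [NumberField K] {T : ℝ} (hT : Real.exp 1 ≤ T)
    (hβN : 2 * β ^ k ≤ Fintype.card (MonomialIndex n D))
    (hDβ : (D + 1) * ((Module.finrank ℚ K : ℝ) ^ 2 * Real.log T) ≤
      (2 ^ (k + 1) * n ^ n : ℕ) * (β : ℝ))
    (X : Set (Fin n → ℝ)) (κ : Fin k → ℕ) :
    ∃ P : MvPolynomial (Fin n) ℝ, P ≠ 0 ∧ P.totalDegree ≤ D ∧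
      ∀ x ∈ {x | x ∈ pointsOfHeightLE X K T ∧ ∃ z ∈ openUnitCube k, θ z = x ∧
        ∀ i, ⌊z i * subdivisions n k a e D β⌋₊ = κ i}, MvPolynomial.eval x P = 0 := by
  refine exists_mvPolynomial_of_det_eq_zero (D := D) _ fun x hx => ?_
  by_contra hdet
  choose z hz hzx hzκ using fun i => (hx i).2
  set R := subdivisions n k a e D β with hR
  have hR0 : (0 : ℝ) < R := by
    have : 0 < R := by rw [hR, subdivisions]; positivity
    exact_mod_cast this
  have hN2 := MonomialIndex.two_le_card hn hD
  obtain ⟨i₀⟩ : Nonempty (MonomialIndex n D) := Fintype.card_pos_iff.1 (by omega)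
  have hdist : ∀ i, ‖z i - z i₀‖ ≤ 1 / R := by
    intro i
    refine (pi_norm_le_iff_of_nonneg (by positivity)).2 fun j => ?_
    have hpos : ∀ i, 0 ≤ z i j * R := fun i => mul_nonneg (hz i j trivial).1.le hR0.le
    have h1 := Nat.floor_le (hpos i)
    have h2 := Nat.lt_floor_add_one (z i j * R)
    have h3 := Nat.floor_le (hpos i₀)
    have h4 := Nat.lt_floor_add_one (z i₀ j * R)
    rw [hzκ i j] at h1 h2
    rw [hzκ i₀ j] at h3 h4
    rw [Pi.sub_apply, Real.norm_eq_abs, le_div_iff₀ hR0, ← abs_of_pos hR0, ← abs_mul, sub_mul,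
      abs_le]
    constructor <;> linarith
  set c := 2 ^ (k + 1) * n ^ n with hc
  have hD' : (0 : ℝ) < D := by exact_mod_cast hD
  have hk' : (0 : ℝ) < k := by exact_mod_cast hk
  have ha' : (0 : ℝ) < a := by exact_mod_cast ha
  have hβ' : (0 : ℝ) < β := by exact_mod_cast hβ
  have hρ : (D : ℝ) * (k * (a * β ^ e)) * (1 / R) ≤ Real.exp (-(8 * n * c)) := by
    have h1 : (R : ℝ) = D * (k * (a * β ^ e)) * 3 ^ (8 * n * c) := by
      rw [hR, subdivisions]; push_cast; rfl
    have h2 : (D : ℝ) * (k * (a * β ^ e)) * (1 / R) = ((3 : ℝ) ^ (8 * n * c))⁻¹ := by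
      rw [h1]; field_simp
    rw [h2, Real.exp_neg]
    gcongr
    have h3 : (8 * n * c : ℝ) = ((8 * n * c : ℕ) : ℝ) * 1 := by push_cast; ring
    rw [h3, Real.exp_nat_mul]
    gcongr
    exact Real.exp_one_lt_three.le
  have hρ1 : (D : ℝ) * (k * (a * β ^ e)) * (1 / R) ≤ 1 :=
    hρ.trans (Real.exp_le_one_iff.2 (by
      have : (0 : ℝ) ≤ 8 * n * c := by positivity
      linarith))
  have hup := abs_det_monomials_le (D := D) hβ (θ := fun j z => θ z j) (by positivity)
    (by positivity) hθ (hz i₀) z hz hdist hρ1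
  simp only [hzx] at hup
  have hlow := one_le_abs_det_mul K x (fun i => (hx i).1.2) hdet
  have hlt := upper_lower_bound_lt_one (N := Fintype.card (MonomialIndex n D)) (D := D) (m := β ^ k)
    (β := β) (c := c) hT hn (Module.finrank_pos (R := ℚ) (M := K)) (by omega)
    MonomialIndex.card_le hβN hDβ (by positivity) hρ
  have hT0 : 0 < T := (Real.exp_pos 1).trans_le hT
  -- a nonzero determinant would have its upper bound below its lower bound
  have := hlow.trans (mul_le_mul_of_nonneg_right hup (by positivity))
  exact absurd this (not_le.2 hlt)

/-- The explicit covering: `J` times the number of cells hypersurfaces suffice. -/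
lemma exists_cover_of_derivBound {n k a e D β J : ℕ} (hk : 0 < k) (hn : 0 < n) (ha : 0 < a)
    (hD : 1 ≤ D) (hβ : 1 ≤ β) {θ : Fin J → (Fin k → ℝ) → Fin n → ℝ}
    (hθ : ∀ i j, DerivBound (openUnitCube k) β (k * (a * β ^ e)) fun z => θ i z j)
    {X : Set (Fin n → ℝ)} (hX : X ⊆ ⋃ j, θ j '' openUnitCube k)
    (K : Subfield ℂ) [NumberField K] {T : ℝ} (hT : Real.exp 1 ≤ T)
    (hβN : 2 * β ^ k ≤ Fintype.card (MonomialIndex n D))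
    (hDβ : (D + 1) * ((Module.finrank ℚ K : ℝ) ^ 2 * Real.log T) ≤
      (2 ^ (k + 1) * n ^ n : ℕ) * (β : ℝ)) {Y : ℝ} (hY : (D : ℝ) ≤ Y) :
    ∃ Z : Set (Set (Fin n → ℝ)), Z.Finite ∧ Z.ncard ≤ J * subdivisions n k a e D β ^ k ∧
      (∀ z ∈ Z, IsHypersurfaceOfDegreeLE Y z) ∧ pointsOfHeightLE X K T ⊆ ⋃₀ Z := by
  set R := subdivisions n k a e D β with hR
  have hR0 : (0 : ℝ) < R := by
    have : 0 < R := by rw [hR, subdivisions]; positivity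
    exact_mod_cast this
  have := exists_finite_cover_hypersurfaces (Y := pointsOfHeightLE X K T)
    (I := Fin J × (Fin k → Fin R))
    (fun I => {x | x ∈ pointsOfHeightLE X K T ∧ ∃ z ∈ openUnitCube k, θ I.1 z = x ∧
        ∀ i, ⌊z i * R⌋₊ = I.2 i}) (fun x hx => ?_) Y (fun I => ?_)
  · simpa using this
  · obtain ⟨j, z, hz, rfl⟩ := Set.mem_iUnion.1 (hX hx.1)
    refine Set.mem_iUnion.2 ⟨(j, fun i => ⟨⌊z i * R⌋₊, ?_⟩), hx, z, hz, rfl, fun _ => rfl⟩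
    have := hz i trivial
    rw [Nat.floor_lt (mul_nonneg this.1.le hR0.le)]
    nlinarith [this.2]
  · obtain ⟨P, h0, h1, h2⟩ := exists_mvPolynomial_on_cell hk hn ha hD hβ (hθ I.1) K hT hβN hDβ X
      (fun i => (I.2 i : ℕ))
    exact ⟨P, h0, le_trans (by exact_mod_cast h1) hY, h2⟩

/-- A set parametrized by points is covered by hyperplanes. -/
lemma exists_cover_of_zero_dim {n J : ℕ} (hn : 0 < n) (θ : Fin J → (Fin 0 → ℝ) → Fin n → ℝ)
    {X Y : Set (Fin n → ℝ)} (hX : X ⊆ ⋃ j, θ j '' openUnitCube 0) (hYX : Y ⊆ X) :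
    ∃ Z : Set (Set (Fin n → ℝ)), Z.Finite ∧ Z.ncard ≤ J ∧
      (∀ z ∈ Z, IsHypersurfaceOfDegreeLE 1 z) ∧ Y ⊆ ⋃₀ Z := by
  have := exists_finite_cover_hypersurfaces (Y := Y) (fun j => θ j '' openUnitCube 0)
    (hYX.trans hX) 1 (fun j => ?_)
  · simpa using this
  · refine ⟨MvPolynomial.X ⟨0, hn⟩ - MvPolynomial.C (θ j 0 ⟨0, hn⟩), fun h => ?_, ?_, ?_⟩
    · have := congrArg (MvPolynomial.coeff (Finsupp.single ⟨0, hn⟩ 1)) h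
      simp [MvPolynomial.coeff_C, Finsupp.single_eq_zero, eq_comm (a := (0 : Fin n →₀ ℕ))] at this
    · have := MvPolynomial.totalDegree_sub_C_le (MvPolynomial.X (R := ℝ) (⟨0, hn⟩ : Fin n))
        (θ j 0 ⟨0, hn⟩)
      rw [MvPolynomial.totalDegree_X] at this
      exact_mod_cast this
    · rintro _ ⟨z, -, rfl⟩
      simp [Subsingleton.elim z 0]

/-! ### The constants -/

/-- The constant factor in the number of hypersurfaces, as a function of `(J, A, C, n, k)`.
The value `A + 1` in place of `A` keeps the number of subdivisions positive when `A = 0`. -/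
def coverConst (p : ℕ × ℕ × ℕ × ℕ × ℕ) : ℕ :=
  p.1 * ((p.2.2.2.2 * (p.2.1 + 1)) *
    3 ^ (8 * p.2.2.2.1 * (2 ^ (p.2.2.2.2 + 1) * p.2.2.2.1 ^ p.2.2.2.1))) ^ p.2.2.2.2 *
      2 ^ (p.2.2.2.1 * p.2.2.1 * p.2.2.2.2)

/-- The exponent of `d ^ 2 log T` in the number of hypersurfaces. -/
def coverExponent (p : ℕ × ℕ × ℕ × ℕ × ℕ) : ℕ :=
  p.2.2.2.2 * p.2.2.2.2 + p.2.2.2.2 * p.2.2.2.1 * p.2.2.1 * p.2.2.2.2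

section Computability

variable {f g : ℕ × ℕ × ℕ × ℕ × ℕ → ℕ}

lemma Primrec.mul_fun (hf : Primrec f) (hg : Primrec g) : Primrec fun p => f p * g p :=
  Primrec.nat_mul.comp hf hg

lemma Primrec.add_fun (hf : Primrec f) (hg : Primrec g) : Primrec fun p => f p + g p :=
  Primrec.nat_add.comp hf hg

lemma Primrec.pow_fun (hf : Primrec f) (hg : Primrec g) : Primrec fun p => f p ^ g p :=
  (Primrec₂.unpaired'.1 Nat.Primrec.pow).comp hf hg

lemma computable_coverConst : Computable coverConst := by
  have hJ : Primrec fun p : ℕ × ℕ × ℕ × ℕ × ℕ => p.1 := .fst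
  have h2 : Primrec fun p : ℕ × ℕ × ℕ × ℕ × ℕ => p.2 := .snd
  have hA : Primrec fun p : ℕ × ℕ × ℕ × ℕ × ℕ => p.2.1 := Primrec.fst.comp h2
  have h3 : Primrec fun p : ℕ × ℕ × ℕ × ℕ × ℕ => p.2.2 := Primrec.snd.comp h2
  have hC : Primrec fun p : ℕ × ℕ × ℕ × ℕ × ℕ => p.2.2.1 := Primrec.fst.comp h3
  have h4 : Primrec fun p : ℕ × ℕ × ℕ × ℕ × ℕ => p.2.2.2 := Primrec.snd.comp h3
  have hn : Primrec fun p : ℕ × ℕ × ℕ × ℕ × ℕ => p.2.2.2.1 := Primrec.fst.comp h4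
  have hk : Primrec fun p : ℕ × ℕ × ℕ × ℕ × ℕ => p.2.2.2.2 := Primrec.snd.comp h4
  have hc : ∀ m : ℕ, Primrec fun _ : ℕ × ℕ × ℕ × ℕ × ℕ => m := fun m => .const m
  exact ((hJ.mul_fun (((hk.mul_fun (hA.add_fun (hc 1))).mul_fun
    ((hc 3).pow_fun (((hc 8).mul_fun hn).mul_fun
      (((hc 2).pow_fun (hk.add_fun (hc 1))).mul_fun (hn.pow_fun hn))))).pow_fun hk)).mul_fun
        ((hc 2).pow_fun ((hn.mul_fun hC).mul_fun hk))).to_comp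

lemma primrec_coverExponent : Primrec coverExponent := by
  have h2 : Primrec fun p : ℕ × ℕ × ℕ × ℕ × ℕ => p.2 := .snd
  have h3 : Primrec fun p : ℕ × ℕ × ℕ × ℕ × ℕ => p.2.2 := Primrec.snd.comp h2
  have hC : Primrec fun p : ℕ × ℕ × ℕ × ℕ × ℕ => p.2.2.1 := Primrec.fst.comp h3
  have h4 : Primrec fun p : ℕ × ℕ × ℕ × ℕ × ℕ => p.2.2.2 := Primrec.snd.comp h3
  have hn : Primrec fun p : ℕ × ℕ × ℕ × ℕ × ℕ => p.2.2.2.1 := Primrec.fst.comp h4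
  have hk : Primrec fun p : ℕ × ℕ × ℕ × ℕ × ℕ => p.2.2.2.2 := Primrec.snd.comp h4
  exact (hk.mul_fun hk).add_fun (((hk.mul_fun hn).mul_fun hC).mul_fun hk)

end Computability

lemma mul_subdivisions_pow_le {n k J a e D β : ℕ} {Q : ℝ} (hQ : 1 ≤ Q) (hD : (D : ℝ) ≤ Q ^ k)
    (hβ : (β : ℝ) ≤ 2 ^ n * Q ^ (k * n)) :
    ((J * subdivisions n k (a + 1) e D β ^ k : ℕ) : ℝ) ≤
      coverConst (J, a, e, n, k) * Q ^ coverExponent (J, a, e, n, k) := by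
  have hQ0 : 0 ≤ Q := zero_le_one.trans hQ
  simp only [subdivisions, coverConst, coverExponent]
  push_cast
  set q : ℝ := 3 ^ (8 * n * (2 ^ (k + 1) * n ^ n))
  calc (J : ℝ) * (D * (k * ((a + 1) * β ^ e)) * q) ^ k
      ≤ J * (Q ^ k * (k * ((a + 1) * (2 ^ n * Q ^ (k * n)) ^ e)) * q) ^ k := by gcongr
    _ = _ := by
      simp only [mul_pow, pow_add, ← pow_mul]
      ring

theorem mainTheorem5 :
    ∃ F₁ F₂ F₃ : ℕ × ℕ × ℕ × ℕ × ℕ → ℕ,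
      Computable F₁ ∧ Computable F₂ ∧ Computable F₃ ∧
      ∀ (J n k : ℕ) (A C : ℝ) (X : Set (Fin n → ℝ)),
        k < n → X ⊆ openUnitCube n → HasMildParametrization k J A C X →
        ∀ (K : Subfield ℂ) [NumberField K] (T : ℝ), Real.exp 1 ≤ T →
          ∃ S : Set (Set (Fin n → ℝ)), S.Finite ∧
            (S.ncard : ℝ) ≤
              (F₁ (J, ⌈A⌉₊, ⌈C⌉₊, n, k) : ℝ)
                * (Module.finrank ℚ K : ℝ) ^ F₂ (J, ⌈A⌉₊, ⌈C⌉₊, n, k)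
                * Real.log T ^ F₃ (J, ⌈A⌉₊, ⌈C⌉₊, n, k) ∧
            (∀ Z ∈ S, IsHypersurfaceOfDegreeLE
              (((Module.finrank ℚ K : ℝ) ^ 2 * Real.log T) ^ ((k : ℝ) / ((n : ℝ) - (k : ℝ)))) Z) ∧
            pointsOfHeightLE X K T ⊆ ⋃₀ S := by
  refine ⟨coverConst, fun p => 2 * coverExponent p, coverExponent, computable_coverConst,
    ((Primrec.const 2).mul_fun primrec_coverExponent).to_comp, primrec_coverExponent.to_comp, ?_⟩
  intro J n k A C X hkn _ hmild K _ T hT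
  obtain ⟨θ, hθ, hX⟩ := hmild
  have hn : 0 < n := by omega
  have hT0 : 0 < T := (Real.exp_pos 1).trans_le hT
  have hlogT : 1 ≤ Real.log T := (Real.le_log_iff_exp_le hT0).2 hT
  have hd : (1 : ℝ) ≤ Module.finrank ℚ K := by
    exact_mod_cast Module.finrank_pos (R := ℚ) (M := K)
  rcases Nat.eq_zero_or_pos k with rfl | hk
  · obtain ⟨Z, hfin, hcard, hZ, hcov⟩ := exists_cover_of_zero_dim hn θ hX
      (fun x (hx : x ∈ pointsOfHeightLE X K T) => hx.1)
    refine ⟨Z, hfin, ?_, by simpa using hZ, hcov⟩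
    simpa [coverConst, coverExponent] using hcard
  · have : NeZero k := ⟨hk.ne'⟩
    set Q : ℝ := (Module.finrank ℚ K : ℝ) ^ 2 * Real.log T with hQdef
    have hQ : 1 ≤ Q := one_le_mul_of_one_le_of_one_le (one_le_pow₀ hd) hlogT
    obtain ⟨hD1, hDQ, β, hβ1, hβN, hDβ, hβQ⟩ := exists_taylor_order hk hkn hQ rfl
    obtain ⟨Z, hfin, hcard, hZ, hcov⟩ := exists_cover_of_derivBound (a := ⌈A⌉₊ + 1) (e := ⌈C⌉₊)
      hk hn (Nat.succ_pos _) hD1 hβ1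
      (fun i j => (hθ i j).derivBound (⌈A⌉₊ + 1) ⌈C⌉₊ β
        ((Nat.le_ceil A).trans (by exact_mod_cast Nat.le_succ _)) (Nat.le_ceil C))
      hX K hT hβN hDβ (Nat.floor_le (by positivity))
    refine ⟨Z, hfin, ?_, hZ, hcov⟩
    calc (Z.ncard : ℝ) ≤ _ := by exact_mod_cast hcard
      _ ≤ _ := mul_subdivisions_pow_le hQ hDQ hβQ
      _ = _ := by rw [hQdef, mul_pow, ← pow_mul, mul_assoc]
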